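/- Setting. Let $p\ge 1$. A unit is $(X,Y(1),Y(0),T)$ with covariates $X\in\mathbb R^p$, real potential outcomes $Y(1),Y(0)$ and binary treatment $T\in\{0,1\}$. The observed data of the unit are $O=(X,T,Y)$ with $Y=TY(1)+(1-T)Y(0)$, and its individual treatment effect is $\Delta=Y(1)-Y(0)$. Let $\mathcal P_{\mathrm{SI}}^{\mathrm{str}}$ be the class of all laws $P$ of $(X,Y(1),Y(0),T)$ such that (a) at least one coordinate of $X$ has a law absolutely continuous with respect to Lebesgue measure on $\mathbb R$, and $Y(1)$ and $Y(0)$ have continuous (atomless) laws; (b) $(Y(1),Y(0))\perp T\mid X$; (c) for some $c_P>0$, the propensity score $e_P(X)=P(T=1\mid X)$ lies in $[c_P,1-c_P]$ almost surely. Conformal meta-learner. Let $m,k\ge 0$. The seed, $m$ training units, $k$ calibration units and one new unit are independent; all units have law $P$, and the seed has a fixed law $\nu$ that does not depend on $P$. From the seed and the observed training data one fits, by arbitrary jointly measurable rules, a pseudo-outcome map $\varphi$ and a real-valued nonconformity score $s(x,y)$ (for instance $|y-\hat\tau(x)|$). The pseudo score of a unit is $V_\varphi=s(X,\varphi(O))$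 and its oracle score is $V^*=s(X,\Delta)$. For $\alpha\in(0,1)$ let $\widehat Q$ be the $\lceil(1-\alpha)(k+1)\rceil$-th smallest pseudo score of the $k$ calibration units, with $\widehat Q=+\infty$ if $\lceil(1-\alpha)(k+1)\rceil>k$. The conformal pseudo-interval is $\widehat C_\varphi(x)=\{y\in\mathbb R: s(x,y)\le\widehat Q\}$. Statement. Suppose that for every $P\in\mathcal P_{\mathrm{SI}}^{\mathrm{str}}$ the pseudo score first-order stochastically dominates the oracle score: for almost every seed and training sample, with the fitted functions held fixed, the scores of a new unit satisfy $$P(V_\varphi\le v)\le P(V^*\le v)\qquad\text{for all }v\in\mathbb R .$$ (Strict inequality for some $v$ is not required.) Then, with $X$ the covariates of the new unit and the probability taken over the seed and all units, $$\mathbb P_P\bigl(y\notin\widehat C_\varphi(X)\bigr)\le\alpha\qquad\text{for all }P\in\mathcal P_{\mathrm{SI}}^{\mathrm{str}}\text{ and all }y\in\mathbb R .$$ Consequently, with $\mathrm{length}$ denoting Lebesgue measure, $$\sup_{P\in\mathcal P_{\mathrm{SI}}^{\mathrm{str}}}\mathbb E_P\bigl[\mathrm{length}(\widehat C_\varphi(X))\bigr]=\infty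 .$$ -/

import Mathlib

open MeasureTheory ProbabilityTheory
open scoped ENNReal

namespace ITE

/-- The covariate space `ℝ^p`. -/
abbrev Cov (p : ℕ) : Type := Fin p → ℝ

/-- Full data `(X, (Y(1), Y(0)), T)` of one unit; the treatment is binary. -/
abbrev FullData (p : ℕ) : Type := Cov p × (ℝ × ℝ) × Bool

/-- Observed data `(X, T, Y)` of one unit. -/
abbrev ObsData (p : ℕ) : Type := Cov p × Bool × ℝ

variable {p : ℕ}

/-- The covariate vector `X`. -/
def covariate (ω : FullData p) : Cov p := ω.1

/-- The pair of potential outcomes `(Y(1), Y(0))`. -/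
def outcomes (ω : FullData p) : ℝ × ℝ := ω.2.1

/-- The treatment indicator `T`. -/
def treatment (ω : FullData p) : Bool := ω.2.2

/-- The individual treatment effect `Δ = Y(1) - Y(0)`. -/
def effect (ω : FullData p) : ℝ := (outcomes ω).1 - (outcomes ω).2

/-- The observed part `(X, T, Y)` with `Y = T Y(1) + (1 - T) Y(0)`. -/
def observe (ω : FullData p) : ObsData p :=
  (covariate ω, treatment ω, if treatment ω then (outcomes ω).1 else (outcomes ω).2)

lemma measurable_covariate : Measurable (covariate : FullData p → Cov p) := measurable_fst

/-- The sigma-field generated by the covariates. -/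
abbrev covariateSigma (p : ℕ) : MeasurableSpace (FullData p) :=
  MeasurableSpace.comap covariate inferInstance

lemma covariateSigma_le (p : ℕ) : covariateSigma p ≤ Prod.instMeasurableSpace :=
  measurable_covariate.comap_le

/-- The class of all laws of `(X, Y(1), Y(0), T)` for which some coordinate of `X` is absolutely
continuous with respect to Lebesgue measure and `Y(1)`, `Y(0)` have continuous (atomless) laws. -/
def baseClass (p : ℕ) : Set (ProbabilityMeasure (FullData p)) :=
  {P | (∃ j : Fin p, (P : Measure (FullData p)).map (fun ω => covariate ω j) ≪ volume) ∧
    (∀ y : ℝ, (P : Measure (FullData p)) {ω | (outcomes ω).1 = y} = 0) ∧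
    (∀ y : ℝ, (P : Measure (FullData p)) {ω | (outcomes ω).2 = y} = 0)}

/-- The strong-ignorability class: `(Y(1), Y(0))` is independent of `T` given `X`. -/
def siClass (p : ℕ) : Set (ProbabilityMeasure (FullData p)) :=
  {P | P ∈ baseClass p ∧
    CondIndepFun (covariateSigma p) (covariateSigma_le p) outcomes treatment
      (P : Measure (FullData p))}

/-- The propensity score `e_P(X) = P(T = 1 | X)`. -/
noncomputable def propensity (P : ProbabilityMeasure (FullData p)) : FullData p → ℝ :=
  (P : Measure (FullData p))⟦treatment ⁻¹' {true}|covariateSigma p⟧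

/-- The strong-overlap class: strong ignorability holds and `e_P(X) ∈ [c, 1 - c]` almost surely,
for some `c > 0` that may depend on `P`. -/
def siStrClass (p : ℕ) : Set (ProbabilityMeasure (FullData p)) :=
  {P | P ∈ siClass p ∧ ∃ c : ℝ, 0 < c ∧
    ∀ᵐ ω ∂(P : Measure (FullData p)), propensity P ω ∈ Set.Icc c (1 - c)}

/-- First-order stochastic dominance of laws on `ℝ`, in its weak form: the cdf of the dominating
law `μ` lies below that of `ν` everywhere. Strict inequality at some point is not required. -/
def FirstOrderDominates (μ ν : Measure ℝ) : Prop := ∀ v : ℝ, cdf μ v ≤ cdf ν v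

/-- A conformal meta-learner with a training sample of size `m` and a random seed in `U`.
The nuisance functions and the effect estimator are fitted on the training sample, with the help
of the seed. After this, `pseudo` turns the observed data of one unit into its pseudo-outcome, and
`score` is the nonconformity score as a function of a covariate value and a (true or pseudo)
treatment effect, for instance `|y - τ̂(x)|`. -/
structure MetaLearner (p m : ℕ) (U : Type*) [MeasurableSpace U] where
  pseudo : U → (Fin m → ObsData p) → ObsData p → ℝ
  score : U → (Fin m → ObsData p) → Cov p → ℝ → ℝ
  measurable_pseudo :
    Measurable fun z : U × (Fin m → ObsData p) × ObsData p => pseudo z.1 z.2.1 z.2.2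
  measurable_score :
    Measurable fun z : U × (Fin m → ObsData p) × Cov p × ℝ => score z.1 z.2.1 z.2.2.1 z.2.2.2

/-- The split-conformal quantile of `k` calibration scores: the `⌈(1 - α)(k + 1)⌉`-th smallest of
them, and `+∞` if that number exceeds `k`. Equivalently, the empirical quantile of order
`(1 - α)(1 + 1/k)`. -/
noncomputable def conformalQuantile {k : ℕ} (α : ℝ) (v : Fin k → ℝ) : EReal :=
  sInf {q : EReal |
    (1 - α) * ((k : ℝ) + 1) ≤ ((Finset.univ.filter fun i => (v i : EReal) ≤ q).card : ℝ)}

namespace MetaLearner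

variable {m : ℕ} {U : Type*} [MeasurableSpace U] (L : MetaLearner p m U)

/-- The oracle score `V^*` of a unit: the score at its treatment effect. -/
def oracleScore (u : U) (d : Fin m → ObsData p) (ω : FullData p) : ℝ :=
  L.score u d (covariate ω) (effect ω)

/-- The pseudo score `V_φ` of an observed unit: the score at its pseudo-outcome. -/
def pseudoScore (u : U) (d : Fin m → ObsData p) (o : ObsData p) : ℝ :=
  L.score u d o.1 (L.pseudo u d o)

/-- The conformal pseudo-interval at level `1 - α`, computed from the seed, the observed training
sample `d` and the observed calibration sample `c`. -/
def pseudoInterval {k : ℕ} (α : ℝ) (u : U) (d : Fin m → ObsData p) (c : Fin k → ObsData p)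
    (x : Cov p) : Set ℝ :=
  {y | (L.score u d x y : EReal) ≤ conformalQuantile α fun i => L.pseudoScore u d (c i)}

/-- Under `P`, the pseudo score dominates the oracle score in first order. Both scores are those
of a new unit, with the fitted functions held fixed; the dominance is required for almost every
seed and training sample. -/
def PseudoDominatesOracle (ν : Measure U) (P : ProbabilityMeasure (FullData p)) : Prop :=
  ∀ᵐ z : U × (Fin m → FullData p)
      ∂(ν.prod (Measure.pi fun _ : Fin m => (P : Measure (FullData p)))),
    FirstOrderDominates
      ((P : Measure (FullData p)).map fun ω =>
        L.pseudoScore z.1 (fun i => observe (z.2 i)) (observe ω))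
      ((P : Measure (FullData p)).map fun ω =>
        L.oracleScore z.1 (fun i => observe (z.2 i)) ω)

end MetaLearner

/-- Seed, training units, calibration units and a new unit. -/
abbrev Experiment (p m k : ℕ) (U : Type*) : Type _ :=
  U × (Fin m → FullData p) × (Fin k → FullData p) × FullData p

/-- The law of the experiment: the seed has law `ν`, and all `m + k + 1` units are i.i.d. with law
`P` and independent of the seed. -/
noncomputable def experimentLaw (m k : ℕ) {U : Type*} [MeasurableSpace U] (ν : Measure U)
    (P : ProbabilityMeasure (FullData p)) : Measure (Experiment p m k U) :=
  ν.prod ((Measure.pi fun _ : Fin m => (P : Measure (FullData p))).prod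
    ((Measure.pi fun _ : Fin k => (P : Measure (FullData p))).prod (P : Measure (FullData p))))

/-- The random set `Ĉ_φ(X)`: the pseudo-interval at the covariates of the new unit. -/
def MetaLearner.intervalAtNew {m k : ℕ} {U : Type*} [MeasurableSpace U] (L : MetaLearner p m U)
    (α : ℝ) (e : Experiment p m k U) : Set ℝ :=
  L.pseudoInterval α e.1 (fun i => observe (e.2.1 i)) (fun i => observe (e.2.2.1 i))
    (covariate e.2.2.2)

end ITE

/-! Fix `y`. When the treatment effect is almost surely `y`, missing `y` means missing the effect of
the new unit. Dominance bounds the probability of this by the probability that the new pseudo score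
exceeds the quantile, and exchangeability of the `k + 1` pseudo scores bounds that by `α`
(`experimentLaw_miss_le`).

For a general `P`, the miss event sees only the observed data of `n = m + k + 1` units
(`experimentLaw_miss`), so it is enough to imitate the observed sample by laws in the class with
effect `y`. This is possible for an observed law `ρ` under which treatment is a function of the
covariates: the missing outcome can be filled in freely, and ignorability holds once treatment is
redrawn from the covariates. Flipping the label with probability `ε` restores overlap, and the
resulting observed law is at least `(1 - ε) • ρ`. A sample thus loses only a factor `(1 - ε) ^ n`,
which tends to `1` (`lintegral_missProb_le`).

A finite sample cannot tell `P` from a mixture of such laws. Cut the absolutely continuous covariate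
into finitely many cells and draw one label per cell in advance; as long as the units fall in
distinct cells, nothing changes (`lintegral_pi_le_of_cellDensity`). Refining the cells makes
coincidences negligible (`tendsto_pi_not_injective_ratCell`). By Tonelli, the expected length is
then at least the integral of `1 - α` over the real line. -/

namespace ITE

/-! ### Finite powers of a measure: densities and domination -/

section Product

variable {Ω : Type*} [MeasurableSpace Ω] {ι ι' : Type*} [Fintype ι] [Fintype ι']

lemma measurePreserving_sumElim (μ : Measure Ω) [SigmaFinite μ] :
    MeasurePreserving (fun z : (ι → Ω) × (ι' → Ω) => (Sum.elim z.1 z.2 : ι ⊕ ι' → Ω))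
      ((Measure.pi fun _ : ι => μ).prod (Measure.pi fun _ : ι' => μ))
      (Measure.pi fun _ : ι ⊕ ι' => μ) := by
  have h := measurePreserving_sumPiEquivProdPi_symm (fun _ : ι ⊕ ι' => μ)
  convert! h using 1

lemma measurePreserving_const_unit (μ : Measure Ω) [SigmaFinite μ] :
    MeasurePreserving (fun (ω : Ω) (_ : Unit) => ω) μ (Measure.pi fun _ : Unit => μ) :=
  (measurePreserving_funUnique μ Unit).symm

lemma lintegral_pi_prod (μ : ι → Measure Ω) [∀ i, IsProbabilityMeasure (μ i)]
    {f : ι → Ω → ℝ≥0∞} (hf : ∀ i, Measurable (f i)) :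
    ∫⁻ w, ∏ i, f i (w i) ∂Measure.pi μ = ∏ i, ∫⁻ x, f i x ∂μ i := by
  have h := lintegral_prod_eq_prod_lintegral_of_indepFun (μ := Measure.pi μ) Finset.univ
    (fun i (w : ι → Ω) => f i (w i)) (iIndepFun_pi fun i => (hf i).aemeasurable)
    (fun i => (hf i).comp (measurable_pi_apply i))
  rw [h]
  refine Finset.prod_congr rfl fun i _ => ?_
  exact (measurePreserving_eval μ i).lintegral_comp (hf i)

lemma pi_withDensity (μ : Measure Ω) [IsProbabilityMeasure μ] {r : Ω → ℝ≥0∞} (hr : Measurable r)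
    [SigmaFinite (μ.withDensity r)] :
    (Measure.pi fun _ : ι => μ.withDensity r) =
      (Measure.pi fun _ : ι => μ).withDensity fun w => ∏ i, r (w i) := by
  refine Measure.pi_eq fun s hs => ?_
  rw [withDensity_apply _ (MeasurableSet.univ_pi hs), ← lintegral_indicator (MeasurableSet.univ_pi hs)]
  simp_rw [withDensity_apply _ (hs _), ← lintegral_indicator (hs _)]
  rw [← lintegral_pi_prod (fun _ => μ) fun i => hr.indicator (hs i)]
  refine lintegral_congr fun w => ?_
  by_cases hw : w ∈ Set.univ.pi s
  · rw [Set.indicator_of_mem hw]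
    exact Finset.prod_congr rfl fun i _ => (Set.indicator_of_mem (hw i trivial) _).symm
  · rw [Set.indicator_of_notMem hw]
    obtain ⟨i, hi⟩ : ∃ i, w i ∉ s i := by simpa using hw
    exact (Finset.prod_eq_zero (Finset.mem_univ i) (Set.indicator_of_notMem hi _)).symm

/-- Domination up to a constant passes to finite powers. -/
lemma pow_smul_pi_le {ρ μ : Measure Ω} [IsProbabilityMeasure ρ] [IsProbabilityMeasure μ]
    {a : ℝ≥0∞} (h : a • ρ ≤ μ) :
    a ^ Fintype.card ι • (Measure.pi fun _ : ι => ρ) ≤ Measure.pi fun _ : ι => μ := by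
  have ha : a ≤ 1 := by simpa using h Set.univ
  have ha' : a ≠ ∞ := ne_top_of_le_ne_top ENNReal.one_ne_top ha
  have : IsFiniteMeasure (a • ρ) := ⟨by simpa using ha'.lt_top⟩
  have hac : a • ρ ≪ μ := Measure.absolutelyContinuous_of_le h
  -- The density of `a • ρ` is at most `1`, hence so is its product over coordinates, which is the
  -- density of the power.
  set f := (a • ρ).rnDeriv μ with hf
  have hfm : Measurable f := Measure.measurable_rnDeriv _ _
  have hfe : μ.withDensity f = a • ρ := Measure.withDensity_rnDeriv_eq _ _ hac
  have hf1 : ∀ᵐ x ∂μ, f x ≤ 1 := Measure.rnDeriv_le_one_of_le h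
  have : IsFiniteMeasure (μ.withDensity f) := by rw [hfe]; infer_instance
  have h1 : (Measure.pi fun _ : ι => a • ρ) =
      (Measure.pi fun _ : ι => μ).withDensity fun w => ∏ i, f (w i) := by
    rw [← pi_withDensity μ hfm, hfe]
  have h2 : (Measure.pi fun _ : ι => a • ρ) = a ^ Fintype.card ι • (Measure.pi fun _ : ι => ρ) := by
    refine Measure.pi_eq fun s hs => ?_
    simp [Measure.pi_pi, Finset.prod_mul_distrib]
  rw [← h2, h1]
  have h3 : ∀ᵐ w ∂(Measure.pi fun _ : ι => μ), ∏ i, f (w i) ≤ 1 := by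
    have : ∀ᵐ w ∂(Measure.pi fun _ : ι => μ), ∀ i, f (w i) ≤ 1 :=
      ae_all_iff.2 fun i => (measurePreserving_eval (fun _ : ι => μ) i).quasiMeasurePreserving.ae hf1
    filter_upwards [this] with w hw
    exact Finset.prod_le_one' fun i _ => hw i
  calc _ ≤ (Measure.pi fun _ : ι => μ).withDensity 1 := withDensity_mono h3
    _ = _ := withDensity_one

end Product

/-! ### Ranks of exchangeable scores -/

section Rank

variable {ι : Type*} [Fintype ι]

/-- At most a fraction `α` of the points of a finite family lie above a fraction `1 - α` of it. -/
lemma card_high_rank_le (f : ι → ℝ) {α : ℝ} (hα : α ∈ Set.Ioo (0 : ℝ) 1) :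
    ((Finset.univ.filter fun j => (1 - α) * Fintype.card ι ≤
      ((Finset.univ.filter fun i => f i < f j).card : ℝ)).card : ℝ) ≤ α * Fintype.card ι := by
  classical
  set J := Finset.univ.filter fun j => (1 - α) * Fintype.card ι ≤
      ((Finset.univ.filter fun i => f i < f j).card : ℝ) with hJ
  rcases J.eq_empty_or_nonempty with h | h
  · rw [h]
    simpa using mul_nonneg hα.1.le (Nat.cast_nonneg _)
  -- The points strictly below the lowest member of `J` lie outside `J` and already make up a
  -- fraction `1 - α`.
  · obtain ⟨j, hj, hmin⟩ := J.exists_min_image f h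
    have hdisj : Disjoint J (Finset.univ.filter fun i => f i < f j) := by
      rw [Finset.disjoint_left]
      intro i hi hi'
      exact absurd (Finset.mem_filter.1 hi').2 (not_lt.2 (hmin i hi))
    have hle := Finset.card_le_univ (J ∪ Finset.univ.filter fun i => f i < f j)
    rw [Finset.card_union_of_disjoint hdisj] at hle
    have hj' := (Finset.mem_filter.1 hj).2
    have : (J.card : ℝ) + ((Finset.univ.filter fun i => f i < f j).card : ℝ) ≤ Fintype.card ι := by
      exact_mod_cast hle
    linarith

lemma measurable_card_lt {S : Type*} [MeasurableSpace S] {f : ι → S → ℝ} {g : S → ℝ}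
    (hf : ∀ i, Measurable (f i)) (hg : Measurable g) :
    Measurable fun z => ((Finset.univ.filter fun i => f i z < g z).card : ℝ) := by
  simp_rw [Finset.card_filter, Nat.cast_sum]
  refine Finset.measurable_sum _ fun i _ => ?_
  simp_rw [Nat.cast_ite]
  exact Measurable.ite (measurableSet_lt (hf i) hg) measurable_const measurable_const

/-- Validity of ranks of independent and identically distributed scores. -/
lemma pi_rank_le {Ω : Type*} [MeasurableSpace Ω] (μ : Measure Ω) [IsProbabilityMeasure μ] {f : Ω → ℝ} (hf : Measurable f)
    {α : ℝ} (hα : α ∈ Set.Ioo (0 : ℝ) 1) (j : ι) :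
    (Measure.pi fun _ : ι => μ) {w | (1 - α) * Fintype.card ι ≤
      ((Finset.univ.filter fun i => f (w i) < f (w j)).card : ℝ)} ≤ ENNReal.ofReal α := by
  classical
  set E : ι → Set (ι → Ω) := fun j => {w | (1 - α) * Fintype.card ι ≤
      ((Finset.univ.filter fun i => f (w i) < f (w j)).card : ℝ)} with hE
  have hEm : ∀ j, MeasurableSet (E j) := fun j => measurableSet_le measurable_const
    (measurable_card_lt (fun i => hf.comp (measurable_pi_apply i)) (hf.comp (measurable_pi_apply j)))
  -- Exchangeability: swapping two coordinates preserves the product measure, so the bound on the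
  -- sum over `j'` is shared equally.
  have hperm : ∀ j', (Measure.pi fun _ : ι => μ) (E j') = (Measure.pi fun _ : ι => μ) (E j) := by
    intro j'
    have hmp := measurePreserving_arrowCongr' (fun _ : ι => μ) (fun _ : ι => μ) (Equiv.swap j j')
      (MeasurableEquiv.refl Ω) fun _ => MeasurePreserving.id μ
    rw [← hmp.measure_preimage (hEm j').nullMeasurableSet]
    congr 1
    ext w
    have hw : ∀ i, (MeasurableEquiv.arrowCongr' (Equiv.swap j j') (MeasurableEquiv.refl Ω)) w i =
        w (Equiv.swap j j' i) := fun i => rfl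
    simp only [hE, Set.mem_preimage, Set.mem_ofPred_eq, hw, Equiv.swap_apply_right]
    rw [show (Finset.univ.filter fun i => f (w (Equiv.swap j j' i)) < f (w j)).card =
      (Finset.univ.filter fun i => f (w i) < f (w j)).card from
      Finset.card_equiv (Equiv.swap j j') (by simp)]
  have hsum : ∑ j', (Measure.pi fun _ : ι => μ) (E j') ≤
      ENNReal.ofReal (α * Fintype.card ι) := by
    calc ∑ j', (Measure.pi fun _ : ι => μ) (E j')
        = ∑ j', ∫⁻ w, (E j').indicator 1 w ∂(Measure.pi fun _ : ι => μ) := by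
          simp_rw [lintegral_indicator_one (hEm _)]
      _ = ∫⁻ w, ∑ j', (E j').indicator 1 w ∂(Measure.pi fun _ : ι => μ) :=
          (lintegral_finsetSum _ fun j' _ => measurable_one.indicator (hEm j')).symm
      _ ≤ ∫⁻ _, ENNReal.ofReal (α * Fintype.card ι) ∂(Measure.pi fun _ : ι => μ) := by
          refine lintegral_mono fun w => ?_
          have h := card_high_rank_le (fun i => f (w i)) hα
          have h' : ∑ j', (E j').indicator (1 : (ι → Ω) → ℝ≥0∞) w =
              ((Finset.univ.filter fun j' => w ∈ E j').card : ℝ≥0∞) := by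
            simp [Set.indicator_apply]
          rw [h', ← ENNReal.ofReal_natCast]
          exact ENNReal.ofReal_le_ofReal h
      _ = _ := by simp
  simp_rw [hperm] at hsum
  rw [Finset.sum_const, Finset.card_univ, nsmul_eq_mul, ENNReal.ofReal_mul hα.1.le,
    ENNReal.ofReal_natCast, mul_comm] at hsum
  have : Nonempty ι := ⟨j⟩
  exact (ENNReal.mul_le_mul_iff_left (by simp) (by simp)).1 hsum

end Rank

variable {p : ℕ}

/-- Turns exceedance of the quantile into a count of strictly smaller scores. For the converse, the
witness is the largest score below `s`, which exists because `α < 1` makes the required count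
positive. -/
lemma conformalQuantile_lt_iff {k : ℕ} {α : ℝ} (hα : α < 1) (v : Fin k → ℝ) (s : ℝ) :
    conformalQuantile α v < (s : EReal) ↔
      (1 - α) * ((k : ℝ) + 1) ≤ ((Finset.univ.filter fun i => v i < s).card : ℝ) := by
  rw [conformalQuantile, sInf_lt_iff]
  constructor
  · rintro ⟨q, hq, hqs⟩
    refine le_trans hq ?_
    exact_mod_cast Finset.card_le_card fun i hi => by
      simp only [Finset.mem_filter, Finset.mem_univ, true_and] at hi ⊢
      exact EReal.coe_lt_coe_iff.1 (hi.trans_lt hqs)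
  · intro h
    have hpos : 0 < (1 - α) * ((k : ℝ) + 1) := mul_pos (by linarith) (by positivity)
    have hne : (Finset.univ.filter fun i => v i < s).Nonempty := by
      rw [← Finset.card_pos]
      exact_mod_cast hpos.trans_le h
    obtain ⟨j, hj, hmax⟩ := Finset.exists_max_image _ v hne
    refine ⟨v j, le_trans h ?_, EReal.coe_lt_coe_iff.2 (Finset.mem_filter.1 hj).2⟩
    exact_mod_cast Finset.card_le_card fun i hi => by
      simp only [Finset.mem_filter, Finset.mem_univ, true_and]
      exact hmax i (Finset.mem_filter.2 ⟨Finset.mem_univ i, by simpa using hi⟩)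

lemma measurable_observe : Measurable (observe : FullData p → ObsData p) := by
  refine measurable_fst.prodMk ((measurable_snd.comp measurable_snd).prodMk ?_)
  refine Measurable.ite ?_ (measurable_fst.comp (measurable_fst.comp measurable_snd))
    (measurable_snd.comp (measurable_fst.comp measurable_snd))
  exact (measurable_snd.comp measurable_snd) (measurableSet_singleton true)

lemma measurable_effect : Measurable (effect : FullData p → ℝ) := by
  unfold effect outcomes
  fun_prop

/-- The law of the observed data of a unit. -/
noncomputable def observedLaw (P : ProbabilityMeasure (FullData p)) : Measure (ObsData p) :=
  (P : Measure (FullData p)).map observe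

instance (P : ProbabilityMeasure (FullData p)) : IsProbabilityMeasure (observedLaw P) :=
  Measure.isProbabilityMeasure_map measurable_observe.aemeasurable

/-! ### The miss event: measurability, dependence on observed data, oracle bound -/

namespace MetaLearner

variable {m k : ℕ} {U : Type*} [MeasurableSpace U] (L : MetaLearner p m U) {α : ℝ}

lemma notMem_pseudoInterval_iff (hα : α < 1) (u : U) (d : Fin m → ObsData p)
    (c : Fin k → ObsData p) (x : Cov p) (y : ℝ) :
    y ∉ L.pseudoInterval α u d c x ↔ (1 - α) * ((k : ℝ) + 1) ≤
      ((Finset.univ.filter fun i => L.pseudoScore u d (c i) < L.score u d x y).card : ℝ) := by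
  rw [← conformalQuantile_lt_iff hα]
  change ¬ (_ : EReal) ≤ _ ↔ _
  rw [not_le]

section Measurability

variable {S : Type*} [MeasurableSpace S] {u : S → U} {d : S → Fin m → ObsData p}

lemma measurable_score_comp (hu : Measurable u) (hd : Measurable d) {x : S → Cov p} {y : S → ℝ}
    (hx : Measurable x) (hy : Measurable y) :
    Measurable fun z => L.score (u z) (d z) (x z) (y z) :=
  L.measurable_score.comp (hu.prodMk (hd.prodMk (hx.prodMk hy)))

lemma measurable_pseudoScore_comp (hu : Measurable u) (hd : Measurable d) {o : S → ObsData p}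
    (ho : Measurable o) : Measurable fun z => L.pseudoScore (u z) (d z) (o z) :=
  L.measurable_score_comp hu hd (measurable_fst.comp ho)
    (L.measurable_pseudo.comp (hu.prodMk (hd.prodMk ho)))

lemma measurableSet_notMem_pseudoInterval (hα : α < 1) (hu : Measurable u) (hd : Measurable d)
    {c : S → Fin k → ObsData p} {x : S → Cov p} {y : S → ℝ}
    (hc : Measurable c) (hx : Measurable x) (hy : Measurable y) :
    MeasurableSet {z | y z ∉ L.pseudoInterval α (u z) (d z) (c z) (x z)} := by
  simp_rw [L.notMem_pseudoInterval_iff hα]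
  exact measurableSet_le measurable_const (measurable_card_lt
    (fun i => L.measurable_pseudoScore_comp hu hd ((measurable_pi_apply i).comp hc))
    (L.measurable_score_comp hu hd hx hy))

/-- Joint measurability in the experiment and the point is what Tonelli needs for the expected
length. -/
lemma measurableSet_notMem_intervalAtNew (hα : α < 1) :
    MeasurableSet {z : Experiment p m k U × ℝ | z.2 ∉ L.intervalAtNew α z.1} := by
  have hobs : ∀ {n : ℕ} {f : Experiment p m k U × ℝ → Fin n → FullData p},
      Measurable f → Measurable fun z i => observe (f z i) := fun hf =>
    measurable_pi_lambda _ fun i => measurable_observe.comp ((measurable_pi_apply i).comp hf)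
  exact L.measurableSet_notMem_pseudoInterval hα (measurable_fst.comp measurable_fst)
    (hobs (measurable_fst.comp (measurable_snd.comp measurable_fst)))
    (hobs (measurable_fst.comp (measurable_snd.comp (measurable_snd.comp measurable_fst))))
    (measurable_covariate.comp (measurable_snd.comp (measurable_snd.comp
      (measurable_snd.comp measurable_fst))))
    measurable_snd

end Measurability

/-- The probability over the seed that `y` is missed, as a function of the observed sample. -/
noncomputable def missProb (ν : Measure U) (α y : ℝ)
    (o : Fin m ⊕ (Fin k ⊕ Unit) → ObsData p) : ℝ≥0∞ :=
  ν {u | y ∉ L.pseudoInterval α u (fun i => o (.inl i)) (fun i => o (.inr (.inl i)))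
    (o (.inr (.inr ()))).1}

variable (ν : Measure U) [IsProbabilityMeasure ν]

lemma measurableSet_miss (hα : α < 1) (y : ℝ) :
    MeasurableSet {z : U × (Fin m ⊕ (Fin k ⊕ Unit) → ObsData p) |
      y ∉ L.pseudoInterval α z.1 (fun i => z.2 (.inl i)) (fun i => z.2 (.inr (.inl i)))
        (z.2 (.inr (.inr ()))).1} :=
  L.measurableSet_notMem_pseudoInterval hα measurable_fst (by fun_prop) (by fun_prop)
    (by fun_prop) measurable_const

lemma measurable_missProb (hα : α < 1) (y : ℝ) :
    Measurable (L.missProb ν α y : (Fin m ⊕ (Fin k ⊕ Unit) → ObsData p) → ℝ≥0∞) :=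
  measurable_measure_prodMk_right (L.measurableSet_miss hα y)

/-- The interval uses the units only through `observe`, so potential outcomes may be changed as long
as the observed law is kept. -/
lemma experimentLaw_miss (hα : α < 1) (P : ProbabilityMeasure (FullData p)) (y : ℝ) :
    experimentLaw m k ν P {e | y ∉ L.intervalAtNew α e} =
      ∫⁻ o, L.missProb ν α y o
        ∂(Measure.pi fun _ : Fin m ⊕ (Fin k ⊕ Unit) => observedLaw P) := by
  set μ : Measure (FullData p) := (P : Measure (FullData p))
  have h1 := ((MeasurePreserving.id (Measure.pi fun _ : Fin k => μ)).prod
    (measurePreserving_const_unit μ))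
  have h2 := (measurePreserving_sumElim (ι := Fin k) (ι' := Unit) μ).comp h1
  have h3 := (measurePreserving_sumElim (ι := Fin m) (ι' := Fin k ⊕ Unit) μ).comp
    ((MeasurePreserving.id (Measure.pi fun _ : Fin m => μ)).prod h2)
  have h4 := (measurePreserving_pi (fun _ : Fin m ⊕ (Fin k ⊕ Unit) => μ)
    (fun _ => observedLaw P) fun _ => ⟨measurable_observe, rfl⟩).comp h3
  have h5 := (MeasurePreserving.id ν).prod h4
  refine Eq.trans ?_ (Measure.prod_apply_symm (L.measurableSet_miss hα y))
  rw [← h5.measure_preimage (L.measurableSet_miss hα y).nullMeasurableSet]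
  rfl

/-- The oracle form of the coverage guarantee: dominance and a constant treatment effect. -/
lemma experimentLaw_miss_le (hα : α ∈ Set.Ioo (0 : ℝ) 1) (P : ProbabilityMeasure (FullData p))
    (hdom : L.PseudoDominatesOracle ν P) {y : ℝ}
    (hy : ∀ᵐ ω ∂(P : Measure (FullData p)), effect ω = y) :
    experimentLaw m k ν P {e | y ∉ L.intervalAtNew α e} ≤ ENNReal.ofReal α := by
  set μ : Measure (FullData p) := (P : Measure (FullData p)) with hμ
  have hmp := measurePreserving_prodAssoc ν (Measure.pi fun _ : Fin m => μ)
    ((Measure.pi fun _ : Fin k => μ).prod μ)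
  have hB : MeasurableSet {e : Experiment p m k U | y ∉ L.intervalAtNew α e} :=
    measurable_prodMk_right (L.measurableSet_notMem_intervalAtNew hα.2)
  rw [experimentLaw, ← hμ, ← hmp.measure_preimage hB.nullMeasurableSet,
    Measure.prod_apply (hmp.measurable hB)]
  calc _ ≤ ∫⁻ _, ENNReal.ofReal α ∂(ν.prod (Measure.pi fun _ : Fin m => μ)) := by
        refine lintegral_mono_ae ?_
        filter_upwards [hdom] with z hz
        set d : Fin m → ObsData p := fun i => observe (z.2 i)
        set V : FullData p → ℝ := fun ω => L.pseudoScore z.1 d (observe ω)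
        have hVm : Measurable V :=
          L.measurable_pseudoScore_comp measurable_const measurable_const measurable_observe
        have hOm : Measurable (L.oracleScore z.1 d) :=
          L.measurable_score_comp measurable_const measurable_const measurable_covariate
            measurable_effect
        have hfix : ∀ c : Fin k → FullData p,
            μ {ω | conformalQuantile α (fun i => V (c i)) <
              (L.score z.1 d (covariate ω) y : EReal)} ≤
            μ {ω | conformalQuantile α (fun i => V (c i)) < (V ω : EReal)} := by
          intro c
          have hae : μ {ω | conformalQuantile α (fun i => V (c i)) <
              (L.score z.1 d (covariate ω) y : EReal)} =
              μ {ω | conformalQuantile α (fun i => V (c i)) <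
              (L.oracleScore z.1 d ω : EReal)} := by
            refine measure_congr ?_
            filter_upwards [hy] with ω hω
            refine propext ?_
            change _ < _ ↔ _ < _
            rw [oracleScore, hω]
          rw [hae]
          -- Infinite thresholds make both events full or both empty; dominance enters at a finite
          -- threshold.
          induction conformalQuantile α (fun i => V (c i)) with
          | bot => simp
          | top => simp
          | coe q =>
            simp_rw [EReal.coe_lt_coe_iff]
            have h := hz q
            have := Measure.isProbabilityMeasure_map (μ := μ) hVm.aemeasurable
            have := Measure.isProbabilityMeasure_map (μ := μ) hOm.aemeasurable
            rw [cdf_eq_real, cdf_eq_real, map_measureReal_apply hVm measurableSet_Iic,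
              map_measureReal_apply hOm measurableSet_Iic] at h
            have e1 : {ω | q < L.oracleScore z.1 d ω} = (L.oracleScore z.1 d ⁻¹' Set.Iic q)ᶜ := by
              ext; simp
            have e2 : {ω | q < V ω} = (V ⁻¹' Set.Iic q)ᶜ := by
              ext; simp
            rw [e1, e2, prob_compl_eq_one_sub (hOm measurableSet_Iic),
              prob_compl_eq_one_sub (hVm measurableSet_Iic)]
            refine tsub_le_tsub_left ?_ 1
            exact (ENNReal.toReal_le_toReal (measure_ne_top _ _) (measure_ne_top _ _)).1 h
        have hSm : MeasurableSet {w : (Fin k → FullData p) × FullData p |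
            conformalQuantile α (fun i => V (w.1 i)) < (V w.2 : EReal)} := by
          simp_rw [conformalQuantile_lt_iff hα.2]
          exact measurableSet_le measurable_const (measurable_card_lt
            (fun i => hVm.comp ((measurable_pi_apply i).comp measurable_fst))
            (hVm.comp measurable_snd))
        have hmp2 := (measurePreserving_sumElim (ι := Fin k) (ι' := Unit) μ).comp
          ((MeasurePreserving.id (Measure.pi fun _ : Fin k => μ)).prod
            (measurePreserving_const_unit μ))
        rw [Measure.prod_apply (measurable_prodMk_left (hmp.measurable hB))]
        calc _ ≤ ∫⁻ c, μ {ω | conformalQuantile α (fun i => V (c i)) < (V ω : EReal)}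
              ∂(Measure.pi fun _ : Fin k => μ) := by
              refine lintegral_mono fun c => le_trans (le_of_eq ?_) (hfix c)
              congr 1
              ext ω
              change ¬ (_ : EReal) ≤ _ ↔ (_ : EReal) < _
              rw [not_le]
              rfl
          _ = ((Measure.pi fun _ : Fin k => μ).prod μ) {w : (Fin k → FullData p) × FullData p |
            conformalQuantile α (fun i => V (w.1 i)) < (V w.2 : EReal)} :=
              (Measure.prod_apply hSm).symm
          _ ≤ ENNReal.ofReal α := by
              -- The new unit becomes one of `k + 1` i.i.d. points, which matches the factor `k + 1`
              -- in the quantile.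
              have hr := pi_rank_le μ hVm hα (Sum.inr () : Fin k ⊕ Unit)
              have hRm : MeasurableSet {w : Fin k ⊕ Unit → FullData p |
                  (1 - α) * (Fintype.card (Fin k ⊕ Unit) : ℝ) ≤ ((Finset.univ.filter
                    fun i => V (w i) < V (w (Sum.inr ()))).card : ℝ)} :=
                measurableSet_le measurable_const (measurable_card_lt
                  (fun i => hVm.comp (measurable_pi_apply i)) (hVm.comp (measurable_pi_apply _)))
              rw [← hmp2.measure_preimage hRm.nullMeasurableSet] at hr
              refine le_trans (measure_mono ?_) hr
              rintro ⟨c, ω⟩ hw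
              have hw' := (conformalQuantile_lt_iff hα.2 _ _).1 hw
              have hcard : (1 - α) * (Fintype.card (Fin k ⊕ Unit) : ℝ) =
                (1 - α) * ((k : ℝ) + 1) := by simp
              refine hcard.le.trans (hw'.trans ?_)
              refine Nat.cast_le.2 (Finset.card_le_card_of_injOn Sum.inl (fun i hi => ?_)
                Sum.inl_injective.injOn)
              exact Finset.mem_coe.2 (Finset.mem_filter.2
                  ⟨Finset.mem_univ _, (Finset.mem_filter.1 (Finset.mem_coe.1 hi)).2⟩)
    _ = ENNReal.ofReal α := by simp

end MetaLearner

/-! ### Laws with treatment assigned from the covariates alone -/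

section Assignment

/-- Reassociation `((x, o), t) ↦ (x, o, t)`. -/
def assemble (z : (Cov p × (ℝ × ℝ)) × Bool) : FullData p := (z.1.1, z.1.2, z.2)

lemma measurable_assemble : Measurable (assemble : (Cov p × (ℝ × ℝ)) × Bool → FullData p) := by
  unfold assemble
  fun_prop

/-- The law of a unit whose covariates and potential outcomes have law `lam`, and whose treatment
is then drawn from `η` given the covariates alone. -/
noncomputable def assignLaw (lam : Measure (Cov p × (ℝ × ℝ))) (η : Kernel (Cov p) Bool) :
    Measure (FullData p) :=
  (lam ⊗ₘ η.prodMkRight (ℝ × ℝ)).map assemble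

variable (lam : Measure (Cov p × (ℝ × ℝ))) [IsProbabilityMeasure lam]
  (η : Kernel (Cov p) Bool) [IsMarkovKernel η]

instance : IsProbabilityMeasure (assignLaw lam η) :=
  Measure.isProbabilityMeasure_map measurable_assemble.aemeasurable

lemma lintegral_assignLaw {f : FullData p → ℝ≥0∞} (hf : Measurable f) :
    ∫⁻ ω, f ω ∂(assignLaw lam η) = ∫⁻ z, ∫⁻ t, f (z.1, z.2, t) ∂(η z.1) ∂lam := by
  rw [assignLaw, lintegral_map hf measurable_assemble]
  exact Measure.lintegral_compProd (hf.comp measurable_assemble)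

lemma assignLaw_map_fst :
    (assignLaw lam η).map (fun ω => (covariate ω, outcomes ω)) = lam := by
  rw [assignLaw, Measure.map_map (by unfold covariate outcomes; fun_prop) measurable_assemble]
  exact Measure.fst_compProd _ _

lemma condDistrib_treatment_outcomes :
    condDistrib treatment (fun ω => (covariate ω, outcomes ω)) (assignLaw lam η)
      =ᵐ[(assignLaw lam η).map (fun ω => (covariate ω, outcomes ω))] η.prodMkRight (ℝ × ℝ) := by
  have hT : Measurable (treatment : FullData p → Bool) := by unfold treatment; fun_prop
  have hXO : Measurable (fun ω : FullData p => (covariate ω, outcomes ω)) := by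
    unfold covariate outcomes; fun_prop
  refine (condDistrib_ae_eq_iff_measure_eq_compProd _ hT.aemeasurable _).2 ?_
  rw [assignLaw_map_fst, assignLaw, Measure.map_map (hXO.prodMk hT) measurable_assemble]
  exact Measure.map_id

lemma condDistrib_treatment :
    condDistrib treatment covariate (assignLaw lam η)
      =ᵐ[(assignLaw lam η).map covariate] η := by
  have hT : Measurable (treatment : FullData p → Bool) := by unfold treatment; fun_prop
  refine (condDistrib_ae_eq_iff_measure_eq_compProd _ hT.aemeasurable _).2 ?_
  refine Measure.ext_of_lintegral _ fun f hf => ?_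
  rw [lintegral_map hf (measurable_covariate.prodMk hT), Measure.lintegral_compProd hf,
    lintegral_map (by fun_prop) measurable_covariate,
    lintegral_assignLaw lam η (f := fun ω => f (covariate ω, treatment ω))
      (hf.comp (measurable_covariate.prodMk hT)),
    lintegral_assignLaw lam η (f := fun ω => ∫⁻ t, f (covariate ω, t) ∂(η (covariate ω)))]
  · simp only [covariate, treatment, lintegral_const, measure_univ, mul_one]
  · have : Measurable fun x => ∫⁻ t, f (x, t) ∂(η x) := by fun_prop
    exact this.comp measurable_covariate

/-- The conditional law of treatment is `η` at the covariates, whether or not one also conditions on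
the outcomes: this is ignorability, and it identifies the propensity score. -/
lemma assignLaw_mem_siStrClass {c : ℝ} (hc : 0 < c)
    (hη : ∀ x, (η x).real {true} ∈ Set.Icc c (1 - c))
    (hX : ∃ j : Fin p, lam.map (fun z => z.1 j) ≪ volume)
    (h1 : ∀ y : ℝ, lam {z | z.2.1 = y} = 0) (h0 : ∀ y : ℝ, lam {z | z.2.2 = y} = 0) :
    (⟨assignLaw lam η, inferInstance⟩ : ProbabilityMeasure (FullData p)) ∈ siStrClass p := by
  have hT : Measurable (treatment : FullData p → Bool) := by unfold treatment; fun_prop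
  have hO : Measurable (outcomes : FullData p → ℝ × ℝ) := by unfold outcomes; fun_prop
  have hXO : Measurable (fun ω : FullData p => (covariate ω, outcomes ω)) :=
    measurable_covariate.prodMk hO
  have hatom : ∀ s : Set (Cov p × (ℝ × ℝ)), MeasurableSet s →
      assignLaw lam η ((fun ω => (covariate ω, outcomes ω)) ⁻¹' s) = lam s := fun s hs => by
    rw [← Measure.map_apply hXO hs, assignLaw_map_fst]
  refine ⟨⟨⟨?_, fun y => ?_, fun y => ?_⟩, ?_⟩, c, hc, ?_⟩
  · obtain ⟨j, hj⟩ := hX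
    refine ⟨j, ?_⟩
    have : (assignLaw lam η).map (fun ω => covariate ω j) = lam.map (fun z => z.1 j) := by
      conv_rhs => rw [← assignLaw_map_fst lam η]
      rw [Measure.map_map (by fun_prop) hXO]
      rfl
    exact this ▸ hj
  · exact (hatom {z | z.2.1 = y} (measurableSet_eq_fun (by fun_prop) (by fun_prop))).trans (h1 y)
  · exact (hatom {z | z.2.2 = y} (measurableSet_eq_fun (by fun_prop) (by fun_prop))).trans (h0 y)
  · refine (condIndepFun_iff_condDistrib_prod_ae_eq_prodMkRight (μ := assignLaw lam η)
      hT hO measurable_covariate).2 ?_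
    refine (condDistrib_treatment_outcomes lam η).trans ?_
    have h := condDistrib_treatment lam η
    rw [show (assignLaw lam η).map covariate = ((assignLaw lam η).map
      (fun ω => (covariate ω, outcomes ω))).map Prod.fst by
        rw [Measure.map_map measurable_fst hXO]; rfl] at h
    filter_upwards [ae_of_ae_map measurable_fst.aemeasurable h] with z hz
    simp only [Kernel.prodMkRight_apply]
    exact hz.symm
  · have h := condDistrib_ae_eq_condExp (μ := assignLaw lam η) measurable_covariate hT
      (measurableSet_singleton true)
    have h' := ae_of_ae_map measurable_covariate.aemeasurable (condDistrib_treatment lam η)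
    filter_upwards [h, h'] with ω hω hω'
    rw [show propensity (⟨assignLaw lam η, inferInstance⟩ : ProbabilityMeasure (FullData p)) ω =
      _ from hω.symm, hω']
    exact hη (covariate ω)

end Assignment

/-! ### Replacing random labels by labels fixed on cells -/

section Cells

variable {Ω C : Type*} [MeasurableSpace Ω]

/-- The density that keeps, in each cell `i`, only the units with label `t i`. -/
noncomputable def cellDensity (κ : C → Measure Bool) (c : Ω → C) (T : Ω → Bool) (t : C → Bool)
    (ω : Ω) : ℝ≥0∞ :=
  if T ω = t (c ω) then (κ (c ω) {T ω})⁻¹ else 0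

variable {μ : Measure Ω} {κ : C → Measure Bool} {c : Ω → C} {T : Ω → Bool}

/-- Rules out, almost surely, the value `0⁻¹ = ∞` in `cellDensity`. -/
lemma ae_label_ne_zero [Fintype C]
    (hκ : ∀ i b, μ {ω | c ω = i ∧ T ω = b} = μ {ω | c ω = i} * κ i {b}) :
    ∀ᵐ ω ∂μ, κ (c ω) {T ω} ≠ 0 := by
  have h : ∀ z : C × Bool, ∀ᵐ ω ∂μ, κ z.1 {z.2} = 0 → ¬ (c ω = z.1 ∧ T ω = z.2) := by
    intro z
    by_cases hz : κ z.1 {z.2} = 0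
    · have : μ {ω | c ω = z.1 ∧ T ω = z.2} = 0 := by rw [hκ, hz, mul_zero]
      filter_upwards [measure_eq_zero_iff_ae_notMem.1 this] with ω hω _ using hω
    · exact Filter.Eventually.of_forall fun ω h => absurd h hz
  filter_upwards [ae_all_iff.2 h] with ω hω h0
  exact hω (c ω, T ω) h0 ⟨rfl, rfl⟩

/-- Averaged over the labels, the densities reproduce the law of units in distinct cells. -/
lemma sum_prod_cellDensity {Ω : Type*} {c : Ω → C} {T : Ω → Bool} [Fintype C]
    [DecidableEq C] [∀ i, IsProbabilityMeasure (κ i)] {ι : Type*} [Fintype ι] {w : ι → Ω} (hw : Function.Injective fun i => c (w i))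
    (h0 : ∀ i, κ (c (w i)) {T (w i)} ≠ 0) :
    ∑ t, Measure.pi κ {t} * ∏ i, cellDensity κ c T t (w i) = 1 := by
  -- Distinct cells carry independent labels, so the average of the product factors, each factor
  -- being `κ {b} * (κ {b})⁻¹ = 1` at the label `b` of a unit.
  have hind := (iIndepFun_pi (μ := κ) (X := fun _ b => b) fun i => aemeasurable_id).precomp hw
  have h := lintegral_prod_eq_prod_lintegral_of_indepFun (μ := Measure.pi κ) Finset.univ
    (fun i (t : C → Bool) => cellDensity κ c T t (w i))
    (hind.comp (fun i b => if T (w i) = b then (κ (c (w i)) {T (w i)})⁻¹ else 0)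
      fun i => measurable_of_finite _) fun i => measurable_of_finite _
  rw [lintegral_fintype] at h
  simp_rw [mul_comm (Measure.pi κ {_})]
  rw [h]
  refine Finset.prod_eq_one fun i _ => ?_
  have he := (measurePreserving_eval κ (c (w i))).lintegral_comp
    (f := fun b => if T (w i) = b then (κ (c (w i)) {T (w i)})⁻¹ else 0) (measurable_of_finite _)
  refine he.trans ?_
  rw [lintegral_fintype, Finset.sum_eq_single (T (w i))]
  · rw [if_pos rfl, ENNReal.inv_mul_cancel (h0 i) (measure_ne_top _ _)]
  · intro b _ hb
    rw [if_neg hb.symm, zero_mul]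
  · simp

lemma exists_label_law [MeasurableSpace C] [MeasurableSingletonClass C] [IsFiniteMeasure μ] (hc : Measurable c) (hT : Measurable T) :
    ∃ κ : C → Measure Bool, (∀ i, IsProbabilityMeasure (κ i)) ∧
      ∀ i b, μ {ω | c ω = i ∧ T ω = b} = μ {ω | c ω = i} * κ i {b} := by
  refine ⟨fun i => condDistrib T c μ i, fun i => inferInstance, fun i b => ?_⟩
  have h := congrArg (fun m : Measure (C × Bool) => m ({i} ×ˢ {b}))
    (compProd_map_condDistrib (μ := μ) (X := c) hT.aemeasurable)
  rw [Measure.compProd_apply_prod (measurableSet_singleton i) (measurableSet_singleton b),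
    Measure.restrict_singleton, lintegral_smul_measure, lintegral_dirac,
    Measure.map_apply hc (measurableSet_singleton i), Measure.map_apply (hc.prodMk hT)
      ((measurableSet_singleton i).prod (measurableSet_singleton b))] at h
  exact h.symm

variable [Fintype C] [MeasurableSpace C] [MeasurableSingletonClass C]

lemma measurable_cellDensity (hc : Measurable c) (hT : Measurable T) (t : C → Bool) :
    Measurable (cellDensity κ c T t) := by
  have h : Measurable fun z : C × Bool => if z.2 = t z.1 then (κ z.1 {z.2})⁻¹ else 0 :=
    measurable_of_finite _
  exact h.comp (hc.prodMk hT)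

/-- In cell `i` the label `t i` has conditional probability `κ i {t i}`, so dividing by it gives the
cell back its full mass; `ht` keeps the divisor nonzero. -/
lemma isProbabilityMeasure_withDensity_cellDensity [IsProbabilityMeasure μ]
    [∀ i, IsProbabilityMeasure (κ i)] (hc : Measurable c) (hT : Measurable T)
    (hκ : ∀ i b, μ {ω | c ω = i ∧ T ω = b} = μ {ω | c ω = i} * κ i {b}) {t : C → Bool}
    (ht : Measure.pi κ {t} ≠ 0) :
    IsProbabilityMeasure (μ.withDensity (cellDensity κ c T t)) := by
  have hti : ∀ i, κ i {t i} ≠ 0 := by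
    rw [Measure.pi_singleton] at ht
    exact fun i => Finset.prod_ne_zero_iff.1 ht i (Finset.mem_univ i)
  have hm : ∀ i b, MeasurableSet {ω | c ω = i ∧ T ω = b} := fun i b =>
    (hc (measurableSet_singleton i)).inter (hT (measurableSet_singleton b))
  have hpt : ∀ ω, cellDensity κ c T t ω =
      ∑ i, {ω | c ω = i ∧ T ω = t i}.indicator (fun _ => (κ i {t i})⁻¹) ω := by
    intro ω
    rw [Finset.sum_eq_single (c ω)]
    · by_cases h : T ω = t (c ω)
      · simp [cellDensity, h]
      · simp [cellDensity, h]
    · intro i _ hi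
      exact Set.indicator_of_notMem (fun h => hi h.1.symm) _
    · simp
  have huniv : ∑ i, μ {ω | c ω = i} = 1 := by
    rw [← measure_univ (μ := μ), ← measure_biUnion_finset]
    · congr 1
      ext ω
      simp
    · intro i _ j _ hij
      exact Set.disjoint_left.2 fun ω hi hj => hij (hi.symm.trans hj)
    · exact fun i _ => hc (measurableSet_singleton i)
  constructor
  rw [withDensity_apply _ MeasurableSet.univ, Measure.restrict_univ]
  simp_rw [hpt]
  rw [lintegral_finsetSum _ fun i _ => measurable_const.indicator (hm i _), ← huniv]
  refine Finset.sum_congr rfl fun i _ => ?_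
  rw [lintegral_indicator_const (hm i _), hκ, mul_comm, mul_assoc,
    ENNReal.mul_inv_cancel (hti i) (measure_ne_top _ _), mul_one]

lemma ae_withDensity_cellDensity (hc : Measurable c) (hT : Measurable T) (t : C → Bool) :
    ∀ᵐ ω ∂(μ.withDensity (cellDensity κ c T t)), T ω = t (c ω) := by
  rw [ae_withDensity_iff (measurable_cellDensity hc hT t)]
  refine Filter.Eventually.of_forall fun ω hω => ?_
  by_contra h
  exact hω (if_neg h)

/-- A sample from `μ` is, up to coincidences of cells, a sample from a mixture of laws under
which the label is a function of the cell. -/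
lemma lintegral_pi_le_of_cellDensity [DecidableEq C] [IsProbabilityMeasure μ]
    [∀ i, IsProbabilityMeasure (κ i)] {ι : Type*} [Fintype ι] (hc : Measurable c) (hT : Measurable T)
    (hκ : ∀ i b, μ {ω | c ω = i ∧ T ω = b} = μ {ω | c ω = i} * κ i {b})
    {F : (ι → Ω) → ℝ≥0∞} (hF : Measurable F) (hF1 : ∀ w, F w ≤ 1) {a : ℝ≥0∞}
    (ha : ∀ t, Measure.pi κ {t} ≠ 0 →
      ∫⁻ w, F w ∂(Measure.pi fun _ : ι => μ.withDensity (cellDensity κ c T t)) ≤ a) :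
    ∫⁻ w, F w ∂(Measure.pi fun _ : ι => μ) ≤
      (Measure.pi fun _ : ι => μ) {w | ¬ Function.Injective fun i => c (w i)} + a := by
  have hS : MeasurableSet {w : ι → Ω | ¬ Function.Injective fun i => c (w i)} := by
    have hm : Measurable fun (w : ι → Ω) (i : ι) => c (w i) :=
      measurable_pi_lambda _ fun i => hc.comp (measurable_pi_apply i)
    exact hm (Set.toFinite {g : ι → C | ¬ Function.Injective g}).measurableSet
  have hr := fun t => measurable_cellDensity (κ := κ) hc hT t
  have hrm : ∀ t, Measurable fun w : ι → Ω => ∏ i, cellDensity κ c T t (w i) := fun t =>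
    Finset.measurable_prod _ fun i _ => (hr t).comp (measurable_pi_apply i)
  have h0 : ∀ᵐ w ∂(Measure.pi fun _ : ι => μ), ∀ i, κ (c (w i)) {T (w i)} ≠ 0 :=
    ae_all_iff.2 fun i =>
      (measurePreserving_eval (fun _ : ι => μ) i).quasiMeasurePreserving.ae (ae_label_ne_zero hκ)
  calc ∫⁻ w, F w ∂(Measure.pi fun _ : ι => μ)
      ≤ ∫⁻ w, ({w : ι → Ω | ¬ Function.Injective fun i => c (w i)}.indicator 1 w +
          ∑ t, Measure.pi κ {t} * ((∏ i, cellDensity κ c T t (w i)) * F w))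
          ∂(Measure.pi fun _ : ι => μ) := by
        refine lintegral_mono_ae ?_
        filter_upwards [h0] with w hw
        -- Without coincidences the weights sum to one; otherwise the indicator alone dominates `F`.
        by_cases hinj : Function.Injective fun i => c (w i)
        · simp_rw [← mul_assoc]
          rw [← Finset.sum_mul, sum_prod_cellDensity hinj hw, one_mul]
          exact le_add_self
        · rw [Set.indicator_of_mem (by exact hinj)]
          exact (hF1 w).trans le_self_add
    _ = (Measure.pi fun _ : ι => μ) {w | ¬ Function.Injective fun i => c (w i)} +
          ∑ t, Measure.pi κ {t} *
            ∫⁻ w, (∏ i, cellDensity κ c T t (w i)) * F w ∂(Measure.pi fun _ : ι => μ) := by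
        rw [lintegral_add_left (measurable_one.indicator hS), lintegral_indicator_one hS,
          lintegral_finsetSum]
        · congr 1
          exact Finset.sum_congr rfl fun t _ => lintegral_const_mul _ ((hrm t).mul hF)
        · exact fun t _ => ((hrm t).mul hF).const_mul _
    _ ≤ (Measure.pi fun _ : ι => μ) {w | ¬ Function.Injective fun i => c (w i)} +
          ∑ t, Measure.pi κ {t} * a := by
        refine add_le_add_right (Finset.sum_le_sum fun t _ => ?_) _
        by_cases ht : Measure.pi κ {t} = 0
        · simp [ht]
        · have := isProbabilityMeasure_withDensity_cellDensity hc hT hκ ht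
          refine mul_le_mul_right ?_ _
          refine le_trans (le_of_eq ?_) (ha t ht)
          rw [pi_withDensity μ (hr t), lintegral_withDensity_eq_lintegral_mul _ (hrm t) hF]
          rfl
    _ = _ := by
        rw [← Finset.sum_mul, sum_measure_singleton, Finset.coe_univ, measure_univ, one_mul]

end Cells

/-! ### Refining cells separate an atomless sample -/

section Separation

variable {Ω : Type*} [MeasurableSpace Ω]

/-- The cell of a real number: its comparisons with the first `N` rational numbers. -/
noncomputable def ratCell (N : ℕ) (x : ℝ) : Fin N → Bool :=
  fun i => decide (x < (((Denumerable.eqv ℚ).symm i : ℚ) : ℝ))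

lemma measurable_ratCell (N : ℕ) : Measurable (ratCell N) :=
  measurable_pi_lambda _ fun i => by
    have h : MeasurableSet {x : ℝ | x < (((Denumerable.eqv ℚ).symm i : ℚ) : ℝ)} :=
      measurableSet_Iio
    exact measurable_to_bool (by convert! h using 1; ext; simp [ratCell])

lemma ratCell_eq_of_le {N N' : ℕ} (h : N ≤ N') {x x' : ℝ} (hx : ratCell N' x = ratCell N' x') :
    ratCell N x = ratCell N x' := by
  funext i
  exact congrFun hx (Fin.castLE h i)

lemma exists_ratCell_ne {x x' : ℝ} (h : x ≠ x') : ∃ N, ratCell N x ≠ ratCell N x' := by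
  wlog hlt : x < x' generalizing x x'
  · obtain ⟨N, hN⟩ := this h.symm (lt_of_le_of_ne (not_lt.1 hlt) h.symm)
    exact ⟨N, hN.symm⟩
  obtain ⟨q, hq, hq'⟩ := exists_rat_btwn hlt
  -- The `+ 1` puts the separating rational `q` among those compared.
  refine ⟨Denumerable.eqv ℚ q + 1, fun he => ?_⟩
  have := congrFun he ⟨Denumerable.eqv ℚ q, Nat.lt_succ_self _⟩
  simp only [ratCell, Equiv.symm_apply_apply, decide_eq_decide] at this
  exact absurd (this.1 hq) (not_lt.2 hq'.le)

variable {ι : Type*} [Fintype ι] {μ : Measure Ω} [IsProbabilityMeasure μ] {f : Ω → ℝ}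

/-- Two independent copies of an atomless variable differ almost surely. -/
lemma ae_pi_ne (hf : Measurable f) (hatom : ∀ x, μ {ω | f ω = x} = 0) {i j : ι} (hij : i ≠ j) :
    ∀ᵐ w ∂(Measure.pi fun _ : ι => μ), f (w i) ≠ f (w j) := by
  have hind := (iIndepFun_pi (μ := fun _ : ι => μ) (X := fun _ ω => ω)
    fun i => aemeasurable_id).indepFun hij
  have hmap := (indepFun_iff_map_prod_eq_prod_map_map (measurable_pi_apply i).aemeasurable
    (measurable_pi_apply j).aemeasurable).1 hind
  rw [(measurePreserving_eval (fun _ : ι => μ) i).map_eq,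
    (measurePreserving_eval (fun _ : ι => μ) j).map_eq] at hmap
  have hm : MeasurableSet {z : Ω × Ω | f z.1 = f z.2} :=
    measurableSet_eq_fun (hf.comp measurable_fst) (hf.comp measurable_snd)
  have hz : (μ.prod μ) {z : Ω × Ω | f z.1 = f z.2} = 0 := by
    rw [Measure.measure_prod_null hm]
    refine Filter.Eventually.of_forall fun ω => ?_
    refine Eq.trans (congrArg μ ?_) (hatom (f ω))
    ext ω'
    exact eq_comm
  rw [← hmap, Measure.map_apply ((measurable_pi_apply i).prodMk (measurable_pi_apply j)) hm] at hz
  exact measure_eq_zero_iff_ae_notMem.1 hz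

/-- The events decrease because the cells are nested, and their intersection forces two sampled
values to be equal, which is a null event for an atomless law. -/
lemma tendsto_pi_not_injective_ratCell (hf : Measurable f) (hatom : ∀ x, μ {ω | f ω = x} = 0) :
    Filter.Tendsto (fun N => (Measure.pi fun _ : ι => μ)
      {w | ¬ Function.Injective fun i => ratCell N (f (w i))}) Filter.atTop (nhds 0) := by
  have hanti : Antitone fun N =>
      {w : ι → Ω | ¬ Function.Injective fun i => ratCell N (f (w i))} := by
    intro N N' h w hw hinj
    exact hw fun i j hij => hinj (ratCell_eq_of_le h hij)
  have hS : ∀ N, MeasurableSet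
      {w : ι → Ω | ¬ Function.Injective fun i => ratCell N (f (w i))} := fun N => by
    have hm : Measurable fun (w : ι → Ω) (i : ι) => ratCell N (f (w i)) :=
      measurable_pi_lambda _ fun i =>
        (measurable_ratCell N).comp (hf.comp (measurable_pi_apply i))
    exact hm (Set.toFinite {g : ι → Fin N → Bool | ¬ Function.Injective g}).measurableSet
  have h := tendsto_measure_iInter_atTop (μ := Measure.pi fun _ : ι => μ)
    (fun N => (hS N).nullMeasurableSet) hanti ⟨0, measure_ne_top _ _⟩
  convert! h using 2
  refine (measure_eq_zero_iff_ae_notMem.2 ?_).symm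
  have hne : ∀ᵐ w ∂(Measure.pi fun _ : ι => μ), ∀ i j, i ≠ j → f (w i) ≠ f (w j) := by
    refine ae_all_iff.2 fun i => ae_all_iff.2 fun j => ?_
    by_cases hij : i = j
    · exact Filter.Eventually.of_forall fun w h => absurd hij h
    · filter_upwards [ae_pi_ne hf hatom hij] with w hw _ using hw
  filter_upwards [hne] with w hw hmem
  have hsep : ∀ z : ι × ι, ∃ N, z.1 ≠ z.2 → ratCell N (f (w z.1)) ≠ ratCell N (f (w z.2)) := by
    intro z
    by_cases hz : z.1 = z.2
    · exact ⟨0, fun h => absurd hz h⟩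
    · obtain ⟨N, hN⟩ := exists_ratCell_ne (hw _ _ hz)
      exact ⟨N, fun _ => hN⟩
  choose N hN using hsep
  -- The finitely many pairs are all separated at one common level.
  refine Set.mem_iInter.1 hmem (Finset.univ.sup N) fun i j hij => ?_
  by_contra hne
  exact hN (i, j) hne (ratCell_eq_of_le (Finset.le_sup (f := N) (Finset.mem_univ (i, j))) hij)

end Separation

/-! ### Label noise, which restores overlap -/

section Flip

/-- The label `b`, flipped with probability `ε`. -/
noncomputable def noisyLabel (ε : ℝ) : Kernel Bool Bool where
  toFun b := ENNReal.ofReal (1 - ε) • Measure.dirac b + ENNReal.ofReal ε • Measure.dirac (!b)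
  measurable' := measurable_of_finite _

lemma noisyLabel_apply (ε : ℝ) (b : Bool) : noisyLabel ε b =
    ENNReal.ofReal (1 - ε) • Measure.dirac b + ENNReal.ofReal ε • Measure.dirac (!b) := rfl

lemma isMarkovKernel_noisyLabel {ε : ℝ} (hε : ε ∈ Set.Icc (0 : ℝ) 1) :
    IsMarkovKernel (noisyLabel ε) := by
  refine ⟨fun b => ⟨?_⟩⟩
  rw [noisyLabel_apply]
  simp only [Measure.add_apply, Measure.smul_apply, measure_univ, smul_eq_mul, mul_one]
  rw [← ENNReal.ofReal_add (by linarith [hε.2]) hε.1]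
  simp

lemma noisyLabel_real_true {ε : ℝ} (hε : ε ∈ Set.Ioc (0 : ℝ) (1 / 2)) (b : Bool) :
    (noisyLabel ε b).real {true} ∈ Set.Icc ε (1 - ε) := by
  obtain ⟨h0, h1⟩ := hε
  cases b
  · have : (noisyLabel ε false).real {true} = ε := by
      simp [Measure.real, noisyLabel_apply, h0.le]
    rw [this]
    exact ⟨le_rfl, by linarith⟩
  · have : (noisyLabel ε true).real {true} = 1 - ε := by
      simp [Measure.real, noisyLabel_apply]
      linarith
    rw [this]
    exact ⟨by linarith, le_rfl⟩

lemma le_lintegral_noisyLabel (ε : ℝ) (b : Bool) (f : Bool → ℝ≥0∞) :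
    ENNReal.ofReal (1 - ε) * f b ≤ ∫⁻ t, f t ∂(noisyLabel ε b) := by
  rw [noisyLabel_apply, lintegral_add_measure, lintegral_smul_measure, lintegral_dirac]
  exact le_self_add

end Flip

/-! ### Twin laws with constant treatment effect -/

section Twin

/-- Potential outcomes that agree with the observed outcome and have treatment effect `y`. -/
noncomputable def completeOutcomes (y : ℝ) (o : ObsData p) : Cov p × (ℝ × ℝ) :=
  (o.1, if o.2.1 then (o.2.2, o.2.2 - y) else (o.2.2 + y, o.2.2))

lemma measurableSet_treated : MeasurableSet {o : ObsData p | o.2.1 = true} :=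
  (measurable_fst.comp measurable_snd) (measurableSet_singleton true)

lemma measurable_completeOutcomes (y : ℝ) :
    Measurable (completeOutcomes y : ObsData p → Cov p × (ℝ × ℝ)) :=
  measurable_fst.prodMk
    (Measurable.ite measurableSet_treated (by fun_prop) (by fun_prop))

variable {P : ProbabilityMeasure (FullData p)} {ρ : Measure (ObsData p)}

lemma map_covariate_absolutelyContinuous (hρ : ρ ≪ observedLaw P) {j : Fin p}
    (hj : (P : Measure (FullData p)).map (fun ω => covariate ω j) ≪ volume) :
    ρ.map (fun o => o.1 j) ≪ volume := by
  have h : Measurable fun o : ObsData p => o.1 j := by fun_prop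
  refine (hρ.map h).trans ?_
  rw [observedLaw, Measure.map_map h measurable_observe]
  exact hj

/-- Two levels are needed: a completed outcome takes a given value when the observed one equals that
value in one arm, or its shift by `y` in the other. -/
lemma observedLaw_outcome_eq_zero (hP : P ∈ baseClass p) (a b : ℝ) :
    observedLaw P {o | (o.2.1 = true ∧ o.2.2 = a) ∨ (o.2.1 = false ∧ o.2.2 = b)} = 0 := by
  have hm : MeasurableSet {o : ObsData p |
      (o.2.1 = true ∧ o.2.2 = a) ∨ (o.2.1 = false ∧ o.2.2 = b)} := by
    have h1 : Measurable fun o : ObsData p => o.2.1 := by fun_prop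
    have h2 : Measurable fun o : ObsData p => o.2.2 := by fun_prop
    exact ((h1 (measurableSet_singleton true)).inter (h2 (measurableSet_singleton a))).union
      ((h1 (measurableSet_singleton false)).inter (h2 (measurableSet_singleton b)))
  rw [observedLaw, Measure.map_apply measurable_observe hm]
  refine measure_mono_null ?_ (measure_union_null (hP.2.1 a) (hP.2.2 b))
  rintro ω (⟨h1, h2⟩ | ⟨h1, h2⟩)
  · left
    have h1' : treatment ω = true := h1
    simpa [observe, h1'] using h2
  · right
    have h1' : treatment ω = false := h1
    simpa [observe, h1'] using h2

/-- A law of a unit with treatment effect `y`, built from an observed law `ρ` under which the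
treatment is almost the function `g` of the covariates. -/
noncomputable def twinLaw (ρ : Measure (ObsData p)) (y ε : ℝ) {g : Cov p → Bool}
    (hg : Measurable g) : Measure (FullData p) :=
  assignLaw (ρ.map (completeOutcomes y)) ((noisyLabel ε).comap g hg)

variable [IsProbabilityMeasure ρ] {g : Cov p → Bool} (hg : Measurable g) (y : ℝ) {ε : ℝ}

instance : IsProbabilityMeasure (ρ.map (completeOutcomes y)) :=
  Measure.isProbabilityMeasure_map (measurable_completeOutcomes y).aemeasurable

lemma isProbabilityMeasure_twinLaw (hε : ε ∈ Set.Icc (0 : ℝ) 1) :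
    IsProbabilityMeasure (twinLaw ρ y ε hg) := by
  have := isMarkovKernel_noisyLabel hε
  unfold twinLaw
  infer_instance

/-- Redrawing treatment from `g` of the covariates plus noise gives ignorability and overlap with
constant `ε`; null sets of the covariate and the outcomes are inherited through `hρ`. -/
lemma twinLaw_mem_siStrClass (hε : ε ∈ Set.Ioc (0 : ℝ) (1 / 2)) (hP : P ∈ baseClass p)
    (hρ : ρ ≪ observedLaw P) (hQ : IsProbabilityMeasure (twinLaw ρ y ε hg)) :
    (⟨twinLaw ρ y ε hg, hQ⟩ : ProbabilityMeasure (FullData p)) ∈ siStrClass p := by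
  have := isMarkovKernel_noisyLabel (ε := ε) ⟨hε.1.le, by linarith [hε.2]⟩
  have hm := measurable_completeOutcomes (p := p) y
  refine assignLaw_mem_siStrClass _ _ hε.1 (fun x => noisyLabel_real_true hε (g x)) ?_ ?_ ?_
  · obtain ⟨j, hj⟩ := hP.1
    refine ⟨j, ?_⟩
    rw [Measure.map_map (by fun_prop) hm]
    exact map_covariate_absolutelyContinuous hρ hj
  · intro a
    rw [Measure.map_apply hm (measurableSet_eq_fun (by fun_prop) (by fun_prop))]
    refine measure_mono_null ?_ (hρ (observedLaw_outcome_eq_zero hP a (a - y)))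
    intro o ho
    by_cases h : o.2.1 = true
    · exact Or.inl ⟨h, by simpa [completeOutcomes, h] using ho⟩
    · have h' : o.2.1 = false := by simpa using h
      refine Or.inr ⟨h', ?_⟩
      have : o.2.2 + y = a := by simpa [completeOutcomes, h'] using ho
      linarith
  · intro a
    rw [Measure.map_apply hm (measurableSet_eq_fun (by fun_prop) (by fun_prop))]
    refine measure_mono_null ?_ (hρ (observedLaw_outcome_eq_zero hP (a + y) a))
    intro o ho
    by_cases h : o.2.1 = true
    · refine Or.inl ⟨h, ?_⟩
      have : o.2.2 - y = a := by simpa [completeOutcomes, h] using ho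
      linarith
    · have h' : o.2.1 = false := by simpa using h
      exact Or.inr ⟨h', by simpa [completeOutcomes, h'] using ho⟩

lemma twinLaw_effect (hε : ε ∈ Set.Icc (0 : ℝ) 1) : ∀ᵐ ω ∂(twinLaw ρ y ε hg), effect ω = y := by
  have := isMarkovKernel_noisyLabel hε
  have hXO : Measurable (fun ω : FullData p => (covariate ω, outcomes ω)) := by
    unfold covariate outcomes; fun_prop
  have hm : MeasurableSet {z : Cov p × (ℝ × ℝ) | z.2.1 - z.2.2 = y} :=
    measurableSet_eq_fun (by fun_prop) (by fun_prop)
  refine ae_of_ae_map (p := fun z => z.2.1 - z.2.2 = y) hXO.aemeasurable ?_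
  rw [twinLaw, assignLaw_map_fst, ae_map_iff (measurable_completeOutcomes y).aemeasurable hm]
  refine Filter.Eventually.of_forall fun o => ?_
  unfold completeOutcomes
  split_ifs <;> simp

/-- An unflipped label is `g` of the covariates, hence the original label, and then `observe` undoes
`completeOutcomes`. -/
lemma smul_le_twinLaw_map_observe (hε : ε ∈ Set.Icc (0 : ℝ) 1) (hgρ : ∀ᵐ o ∂ρ, o.2.1 = g o.1) :
    ENNReal.ofReal (1 - ε) • ρ ≤ (twinLaw ρ y ε hg).map observe := by
  have := isMarkovKernel_noisyLabel hε
  refine Measure.le_iff.2 fun s hs => ?_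
  have hf : Measurable fun ω : FullData p => s.indicator (1 : ObsData p → ℝ≥0∞) (observe ω) :=
    (measurable_one.indicator hs).comp measurable_observe
  rw [← lintegral_indicator_one (μ := (twinLaw ρ y ε hg).map observe) hs,
    lintegral_map (measurable_one.indicator hs) measurable_observe,
    twinLaw, lintegral_assignLaw _ _ hf,
    lintegral_map _ (measurable_completeOutcomes y)]
  · rw [Measure.smul_apply, smul_eq_mul, ← lintegral_indicator_one hs,
      ← lintegral_const_mul _ (measurable_one.indicator hs)]
    refine lintegral_mono_ae ?_
    filter_upwards [hgρ] with o ho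
    refine le_trans (le_of_eq ?_) (le_lintegral_noisyLabel ε (g o.1) _)
    congr 2
    obtain ⟨x, t, v⟩ := o
    obtain rfl : t = g x := ho
    cases h : g x <;> simp [observe, covariate, treatment, outcomes, completeOutcomes]
  · have h1 : Measurable fun z : (Cov p × (ℝ × ℝ)) × Bool =>
        s.indicator (1 : ObsData p → ℝ≥0∞) (observe (z.1.1, z.1.2, z.2)) :=
      hf.comp measurable_assemble
    exact h1.lintegral_kernel_prod_right'
      (κ := ((noisyLabel ε).comap g hg).prodMkRight (ℝ × ℝ))

end Twin

/-! ### Coverage of every fixed point and infinite expected length -/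

section Coverage

variable {m k : ℕ} {U : Type*} [MeasurableSpace U] (ν : Measure U) [IsProbabilityMeasure ν]
  (L : MetaLearner p m U) {α : ℝ}

lemma missProb_le_one (y : ℝ) (o : Fin m ⊕ (Fin k ⊕ Unit) → ObsData p) :
    L.missProb ν α y o ≤ 1 := prob_le_one

/-- The coverage guarantee for observed laws under which the covariates determine the
treatment. -/
lemma lintegral_missProb_le (hα : α ∈ Set.Ioo (0 : ℝ) 1)
    (hdom : ∀ P ∈ siStrClass p, L.PseudoDominatesOracle ν P)
    {P : ProbabilityMeasure (FullData p)} (hP : P ∈ baseClass p) {ρ : Measure (ObsData p)}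
    [IsProbabilityMeasure ρ] (hρ : ρ ≪ observedLaw P) {g : Cov p → Bool} (hg : Measurable g)
    (hgρ : ∀ᵐ o ∂ρ, o.2.1 = g o.1) (y : ℝ) :
    ∫⁻ o, L.missProb ν α y o ∂(Measure.pi fun _ : Fin m ⊕ (Fin k ⊕ Unit) => ρ) ≤
      ENNReal.ofReal α := by
  set K := ∫⁻ o, L.missProb ν α y o ∂(Measure.pi fun _ : Fin m ⊕ (Fin k ⊕ Unit) => ρ) with hK
  set n := Fintype.card (Fin m ⊕ (Fin k ⊕ Unit))
  have hbound : ∀ ε ∈ Set.Ioc (0 : ℝ) (1 / 2),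
      ENNReal.ofReal (1 - ε) ^ n * K ≤ ENNReal.ofReal α := by
    intro ε hε
    have hε' : ε ∈ Set.Icc (0 : ℝ) 1 := ⟨hε.1.le, by linarith [hε.2]⟩
    have hQ := isProbabilityMeasure_twinLaw (ρ := ρ) hg y hε'
    set Q : ProbabilityMeasure (FullData p) := ⟨twinLaw ρ y ε hg, hQ⟩ with hQdef
    have hmem : Q ∈ siStrClass p := twinLaw_mem_siStrClass hg y hε hP hρ hQ
    have h := L.experimentLaw_miss_le (k := k) ν hα Q (hdom Q hmem) (twinLaw_effect hg y hε')
    rw [L.experimentLaw_miss ν hα.2] at h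
    refine le_trans ?_ h
    have hle : ENNReal.ofReal (1 - ε) • ρ ≤ observedLaw Q :=
      smul_le_twinLaw_map_observe hg y hε' hgρ
    rw [hK, ← smul_eq_mul, ← lintegral_smul_measure]
    exact lintegral_mono' (pow_smul_pi_le hle) le_rfl
  -- Finiteness of `K` makes the left side of `hbound` continuous in `ε`, so that `ε` can tend to
  -- `0`.
  have hKtop : K ≠ ∞ := by
    refine ne_top_of_le_ne_top ENNReal.one_ne_top ?_
    calc K ≤ ∫⁻ _, 1 ∂(Measure.pi fun _ : Fin m ⊕ (Fin k ⊕ Unit) => ρ) :=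
          lintegral_mono fun o => missProb_le_one ν L y o
      _ = 1 := by simp
  have hc : Continuous fun ε : ℝ => ENNReal.ofReal (1 - ε) ^ n * K := by
    refine (ENNReal.continuous_mul_const hKtop).comp ?_
    exact (ENNReal.continuous_pow n).comp (ENNReal.continuous_ofReal.comp (by fun_prop))
  have hlim : Filter.Tendsto (fun ε : ℝ => ENNReal.ofReal (1 - ε) ^ n * K)
      (nhdsWithin 0 (Set.Ioi 0)) (nhds K) := by
    have := hc.tendsto 0
    simp only [sub_zero, ENNReal.ofReal_one, one_pow, one_mul] at this
    exact this.mono_left nhdsWithin_le_nhds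
  refine le_of_tendsto hlim ?_
  filter_upwards [Ioc_mem_nhdsGT (by norm_num : (0 : ℝ) < 1 / 2)] with ε hε using hbound ε hε

/-- Every fixed point is missed with probability at most `α`. -/
lemma experimentLaw_miss_le_of_dominates (hα : α ∈ Set.Ioo (0 : ℝ) 1)
    (hdom : ∀ P ∈ siStrClass p, L.PseudoDominatesOracle ν P)
    {P : ProbabilityMeasure (FullData p)} (hP : P ∈ baseClass p) (y : ℝ) :
    experimentLaw m k ν P {e | y ∉ L.intervalAtNew α e} ≤ ENNReal.ofReal α := by
  rw [L.experimentLaw_miss ν hα.2]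
  obtain ⟨j, hj⟩ := hP.1
  have hXj : Measurable fun o : ObsData p => o.1 j := by fun_prop
  have hT : Measurable fun o : ObsData p => o.2.1 := by fun_prop
  have hatom : ∀ x, observedLaw P {o | o.1 j = x} = 0 := by
    intro x
    have h := map_covariate_absolutelyContinuous (Measure.AbsolutelyContinuous.refl _) hj
      (measure_singleton x)
    rwa [Measure.map_apply hXj (measurableSet_singleton x)] at h
  have hlim := (tendsto_pi_not_injective_ratCell (ι := Fin m ⊕ (Fin k ⊕ Unit)) hXj
    hatom).add_const (ENNReal.ofReal α)
  rw [zero_add] at hlim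
  -- At each level `N` the bound is `α` plus the probability of a shared cell, which vanishes in the
  -- limit.
  refine ge_of_tendsto' hlim fun N => ?_
  have hc : Measurable fun o : ObsData p => ratCell N (o.1 j) := (measurable_ratCell N).comp hXj
  obtain ⟨κ, hκp, hκ⟩ := exists_label_law (μ := observedLaw P) hc hT
  refine lintegral_pi_le_of_cellDensity hc hT hκ (L.measurable_missProb ν hα.2 y)
    (missProb_le_one ν L y) fun t ht => ?_
  have := isProbabilityMeasure_withDensity_cellDensity hc hT hκ ht
  have hg : Measurable fun x : Cov p => t (ratCell N (x j)) :=
    (measurable_of_finite t).comp ((measurable_ratCell N).comp (measurable_pi_apply j))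
  exact lintegral_missProb_le ν L hα hdom hP (withDensity_absolutelyContinuous _ _) hg
    (ae_withDensity_cellDensity hc hT t) y

/-- By Tonelli, expected length is the integral over `y` of the probability of covering `y`, which
never falls below `1 - α > 0`. -/
lemma lintegral_volume_eq_top (hα : α ∈ Set.Ioo (0 : ℝ) 1) (P : ProbabilityMeasure (FullData p))
    (hmiss : ∀ y : ℝ, experimentLaw m k ν P {e | y ∉ L.intervalAtNew α e} ≤ ENNReal.ofReal α) :
    ∫⁻ e, volume (L.intervalAtNew α e) ∂(experimentLaw m k ν P) = ∞ := by
  have hprob : IsProbabilityMeasure (experimentLaw m k ν P) := by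
    unfold experimentLaw
    infer_instance
  have hB := L.measurableSet_notMem_intervalAtNew (k := k) hα.2
  have hpos : 1 - ENNReal.ofReal α ≠ 0 := by
    rw [ne_eq, tsub_eq_zero_iff_le, not_le]
    exact ENNReal.ofReal_lt_one.2 hα.2
  have h1 : ∫⁻ e, volume (L.intervalAtNew α e) ∂(experimentLaw m k ν P) =
      ∫⁻ y, experimentLaw m k ν P {e | y ∉ L.intervalAtNew α e}ᶜ ∂(volume : Measure ℝ) := by
    have h := (Measure.prod_apply (μ := experimentLaw m k ν P) (ν := (volume : Measure ℝ))
      hB.compl).symm.trans (Measure.prod_apply_symm hB.compl)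
    simp only [Set.preimage_compl] at h
    refine Eq.trans (lintegral_congr fun e => congrArg volume ?_) h
    exact (compl_compl (L.intervalAtNew α e)).symm
  rw [h1, eq_top_iff]
  calc ∞ = ∫⁻ _, (1 - ENNReal.ofReal α) ∂(volume : Measure ℝ) := by
        rw [lintegral_const, Real.volume_univ, ENNReal.mul_top hpos]
    _ ≤ _ := by
        refine lintegral_mono fun y => ?_
        have hm : MeasurableSet {e : Experiment p m k U | y ∉ L.intervalAtNew α e} :=
          measurable_prodMk_right hB
        simp only
        rw [prob_compl_eq_one_sub hm]
        exact tsub_le_tsub_left (hmiss y) 1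

/-- Needed because a supremum over an empty class would be `0`. The witness has independent Gaussian
covariates and outcomes, with treatment a fair coin. -/
lemma siStrClass_nonempty (hp : 0 < p) : (siStrClass p).Nonempty := by
  set γ : Measure ℝ := gaussianReal 0 1
  have hγ : NullSingletonClass γ := nullSingletonClass_gaussianReal one_ne_zero
  have hε : (1 / 2 : ℝ) ∈ Set.Ioc (0 : ℝ) (1 / 2) := ⟨by norm_num, le_rfl⟩
  have := isMarkovKernel_noisyLabel (ε := 1 / 2) ⟨by norm_num, by norm_num⟩
  refine ⟨_, assignLaw_mem_siStrClass ((Measure.pi fun _ : Fin p => γ).prod (γ.prod γ))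
    ((noisyLabel (1 / 2)).comap (fun _ => true) measurable_const) hε.1
    (fun x => noisyLabel_real_true hε true) ⟨⟨0, hp⟩, ?_⟩ (fun y => ?_) (fun y => ?_)⟩
  · have h := (measurePreserving_eval (fun _ : Fin p => γ) ⟨0, hp⟩).comp
      (measurePreserving_fst (μ := Measure.pi fun _ : Fin p => γ) (ν := γ.prod γ))
    exact h.map_eq.symm ▸ gaussianReal_absolutelyContinuous 0 one_ne_zero
  · have h := (measurePreserving_fst (μ := γ) (ν := γ)).comp
      (measurePreserving_snd (μ := Measure.pi fun _ : Fin p => γ) (ν := γ.prod γ))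
    exact (h.measure_preimage (measurableSet_singleton y).nullMeasurableSet).trans
      (measure_singleton y)
  · have h := (measurePreserving_snd (μ := γ) (ν := γ)).comp
      (measurePreserving_snd (μ := Measure.pi fun _ : Fin p => γ) (ν := γ.prod γ))
    exact (h.measure_preimage (measurableSet_singleton y).nullMeasurableSet).trans
      (measure_singleton y)

end Coverage

end ITE

theorem mainTheorem5 (p m k : ℕ) (hp : 0 < p) {U : Type*} [MeasurableSpace U]
    (ν : Measure U) [IsProbabilityMeasure ν] (L : ITE.MetaLearner p m U)
    (α : ℝ) (hα : α ∈ Set.Ioo (0 : ℝ) 1)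
    (hdom : ∀ P ∈ ITE.siStrClass p, L.PseudoDominatesOracle ν P) :
    (∀ P ∈ ITE.siStrClass p, ∀ y : ℝ,
      ITE.experimentLaw m k ν P {e | y ∉ L.intervalAtNew α e} ≤ ENNReal.ofReal α) ∧
    (⨆ P ∈ ITE.siStrClass p,
      ∫⁻ e, volume (L.intervalAtNew α e) ∂(ITE.experimentLaw m k ν P)) = ∞ := by
  have hmiss : ∀ P ∈ ITE.siStrClass p, ∀ y : ℝ,
      ITE.experimentLaw m k ν P {e | y ∉ L.intervalAtNew α e} ≤ ENNReal.ofReal α :=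
    fun P hP y => ITE.experimentLaw_miss_le_of_dominates ν L hα hdom hP.1.1 y
  refine ⟨hmiss, ?_⟩
  obtain ⟨P, hP⟩ := ITE.siStrClass_nonempty hp
  rw [eq_top_iff, ← ITE.lintegral_volume_eq_top (k := k) ν L hα P (hmiss P hP)]
  exact le_iSup₂ (f := fun P (_ : P ∈ ITE.siStrClass p) =>
    ∫⁻ e, volume (L.intervalAtNew α e) ∂(ITE.experimentLaw m k ν P)) P hP
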